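/- Let $N\ge 1$ be an integer and let $B_N=\{z\in\mathbb C^N:|z|<1\}$ be the open Euclidean unit ball. Let $LFT(B_N)$ be the set of linear fractional self-maps of $B_N$, i.e. the maps $\varphi:B_N\to B_N$ of the form $$\varphi(z)=\frac{Az+B}{\langle z,C\rangle+D},\qquad A\in\mathbb C^{N\times N},\ B,C\in\mathbb C^N,\ D\in\mathbb C,$$ where $\langle z,C\rangle=\sum_j z_j\overline{C_j}$ and $\langle z,C\rangle+D\ne 0$ for all $z\in B_N$. For a fixed point $z_0\in B_N$ of $\varphi$, the unitary index of $\varphi$ at $z_0$ is $$u(\varphi,z_0)=\dim\bigoplus_{|\lambda|=1}\ker\,(d\varphi_{z_0}-\lambda E)^N,$$ where $d\varphi_{z_0}$ is the complex derivative of $\varphi$ at $z_0$ and $E$ is the identity. **Proposition.** Let $\varphi\in LFT(B_N)$ be elliptic, i.e. $\varphi$ has a fixed point in $B_N$; let $z_0\in B_N$ be any fixed point of $\varphi$, put $u=u(\varphi,z_0)$ and suppose that $u\ge 1$. Then there are a map $\psi\in LFT(B_N)$, a diagonal unitary $u\times u$ matrix $\Lambda$ and an $(N-u)\times(N-u)$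 complex matrix $A_1$ with spectral radius $\rho(A_1)<1$ and spectral norm (operator norm for the Euclidean norm) $\|A_1\|\le 1$ such that $\varphi$ is conjugate to $\psi$, that is, $\psi=\sigma\circ\varphi\circ\sigma^{-1}$ for some biholomorphic map $\sigma$ of $B_N$ onto $B_N$, and $$\psi(z',z'')=(\Lambda z',A_1z'')\qquad\text{for all }(z',z'')\in(\mathbb C^u\times\mathbb C^{N-u})\cap B_N .$$ (If $u=N$, the block $A_1$ is empty.) -/

import Mathlib

open Metric Set

noncomputable section

namespace LFT

/-- `ℂ^n` with its standard Hermitian inner product and Euclidean norm. -/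
abbrev CSpace (n : ℕ) : Type := EuclideanSpace ℂ (Fin n)

/-- The open unit ball of `ℂ^n`. -/
abbrev unitBall (n : ℕ) : Set (CSpace n) := ball 0 1

/-- The linear action of a square complex matrix on `ℂ^n`. Its norm is the spectral norm of the
matrix. -/
abbrev act {n : ℕ} (A : Matrix (Fin n) (Fin n) ℂ) : CSpace n →L[ℂ] CSpace n :=
  Matrix.toEuclideanCLM (n := Fin n) (𝕜 := ℂ) A

/-- `φ ∈ LFT(B_N)`: `φ` maps the unit ball to itself and is given there by
`φ z = (A z + B) / (⟨z, C⟩ + D)`, with a denominator that has no zero in the ball.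
Here `⟨z, C⟩` is linear in `z`, hence it is `inner ℂ C z`.
The values of `φ` outside the ball are irrelevant. -/
def IsLinearFractionalSelfMap {N : ℕ} (φ : CSpace N → CSpace N) : Prop :=
  MapsTo φ (unitBall N) (unitBall N) ∧
    ∃ (A : Matrix (Fin N) (Fin N) ℂ) (B C : CSpace N) (D : ℂ),
      ∀ z ∈ unitBall N, inner ℂ C z + D ≠ 0 ∧
        φ z = (inner ℂ C z + D)⁻¹ • (act A z + B)

/-- The unitary space of `φ` at `z₀`: the sum of the generalized eigenspaces
`ker (dφ_{z₀} - λ E)^N` over all `λ` with `|λ| = 1` (the sum is automatically direct). -/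
def unitarySpace {N : ℕ} (φ : CSpace N → CSpace N) (z₀ : CSpace N) :
    Submodule ℂ (CSpace N) :=
  ⨆ (lam : ℂ) (_ : ‖lam‖ = 1),
    LinearMap.ker
      (((fderiv ℂ φ z₀ : CSpace N →ₗ[ℂ] CSpace N) - lam • LinearMap.id) ^ N)

/-- The unitary index of `φ` at `z₀`. -/
def unitaryIndex {N : ℕ} (φ : CSpace N → CSpace N) (z₀ : CSpace N) : ℕ :=
  Module.finrank ℂ (unitarySpace φ z₀)

theorem unitaryIndex_le {N : ℕ} (φ : CSpace N → CSpace N) (z₀ : CSpace N) :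
    unitaryIndex φ z₀ ≤ N := by
  have h := Submodule.finrank_le (unitarySpace φ z₀)
  rwa [finrank_euclideanSpace_fin] at h

/-- `σ` is a biholomorphic map from `D` onto `U` with inverse `τ`. -/
structure IsBiholomorphism {N : ℕ} (D U : Set (CSpace N)) (σ τ : CSpace N → CSpace N) : Prop where
  mapsTo : MapsTo σ D U
  mapsTo_inv : MapsTo τ U D
  leftInv : ∀ z ∈ D, τ (σ z) = z
  rightInv : ∀ w ∈ U, σ (τ w) = w
  holomorphic : DifferentiableOn ℂ σ D
  holomorphic_inv : DifferentiableOn ℂ τ U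

/-- The self-map `φ` of `D` is conjugate to the self-map `ψ` of `U`:
`ψ = σ ∘ φ ∘ σ⁻¹` on `U` for a biholomorphic map `σ` from `D` onto `U`. -/
def IsConjugate {N : ℕ} (D U : Set (CSpace N)) (φ ψ : CSpace N → CSpace N) : Prop :=
  ∃ σ τ : CSpace N → CSpace N, IsBiholomorphism D U σ τ ∧ ∀ w ∈ U, ψ w = σ (φ (τ w))

/-- The point `(z', z'')` of `ℂ^N = ℂ^u × ℂ^(N-u)`, for `u ≤ N`. -/
def pair {N u : ℕ} (h : u ≤ N) (z' : CSpace u) (z'' : CSpace (N - u)) : CSpace N :=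
  WithLp.toLp 2 fun k : Fin N =>
    Fin.append (fun i => z' i) (fun j => z'' j) (Fin.cast (Nat.add_sub_of_le h).symm k)

end LFT

end

/-! Conjugation by the ball involution exchanging `0` and `z₀` reduces everything to a map fixing
`0`: linear fractional maps compose because they are linear in homogeneous coordinates, and the
chain rule preserves the unitary index.

A map fixing `0` has the form `A z / (1 + ⟨C, z⟩)`. Rotating `z` to make the denominator as small as
possible gives `‖A w‖ + |⟨C, w⟩| ≤ ‖w‖`. Since `u ≥ 1`, `A` has a unimodular eigenvector, and this
bound then forces `C = 0` (`eq_zero_of_norm_add_norm_inner_le`), so the map is a linear contraction.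

A unimodular eigenvector of a contraction is also an eigenvector of the adjoint
(`adjoint_apply_of_eigenvector`). Hence the unimodular generalized eigenspaces are genuine
eigenspaces, they are pairwise orthogonal, and the orthogonal complement of their sum is invariant.
An adapted orthonormal basis yields the block form (`exists_unitary_block_form`); the change of
basis is unitary, hence an automorphism of the ball. -/

namespace LFT

/-! ### Norm bounds for linear fractional maps and contractions. -/

section Hilbert

variable {E : Type*} [NormedAddCommGroup E] [InnerProductSpace ℂ E]

/-- If `z ↦ A z / (1 + ⟨C, z⟩)` maps the unit ball into itself, then `‖A w‖ + |⟨C, w⟩| ≤ ‖w‖`. -/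
theorem norm_add_norm_inner_le (A : E →L[ℂ] E) (C : E)
    (h : ∀ z, ‖z‖ < 1 → 1 + inner ℂ C z ≠ 0 ∧ ‖A z‖ ≤ ‖1 + inner ℂ C z‖) (w : E) :
    ‖A w‖ + ‖inner ℂ C w‖ ≤ ‖w‖ := by
  have hC : ‖C‖ ≤ 1 := by
    by_contra! hC
    have hC0 : (‖C‖ : ℂ) ≠ 0 := by
      exact_mod_cast (by linarith : ‖C‖ ≠ 0)
    -- The denominator vanishes at `-C / ‖C‖²`, which lies in the ball when `‖C‖ > 1`.
    refine (h (-((‖C‖ : ℂ) ^ 2)⁻¹ • C) ?_).1 ?_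
    · rw [norm_smul, norm_neg, norm_inv, norm_pow, Complex.norm_real, norm_norm, sq, mul_inv,
        mul_assoc, inv_mul_cancel₀ (by linarith), mul_one]
      exact inv_lt_one_of_one_lt₀ hC
    · rw [inner_smul_right, inner_self_eq_norm_sq_to_K]
      have : (RCLike.ofReal ‖C‖ : ℂ) = (‖C‖ : ℂ) := rfl
      rw [this]
      field_simp
      ring
  have key : ∀ z, ‖z‖ < 1 → ‖A z‖ + ‖inner ℂ C z‖ ≤ 1 := by
    intro z hz
    have hq : ‖inner ℂ C z‖ ≤ 1 :=
      (norm_inner_le_norm C z).trans (mul_le_one₀ hC (norm_nonneg _) hz.le)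
    -- Replacing `z` by `θ z` keeps `‖A z‖` and shrinks the denominator to `1 - |⟨C, z⟩|`.
    obtain ⟨θ, hθ, hθz⟩ : ∃ θ : ℂ, ‖θ‖ = 1 ∧ θ * inner ℂ C z = -(‖inner ℂ C z‖ : ℂ) := by
      by_cases h0 : inner ℂ C z = 0
      · exact ⟨1, by simp, by simp [h0]⟩
      · have h0' : (‖inner ℂ C z‖ : ℂ) ≠ 0 := by simpa using h0
        refine ⟨-(‖inner ℂ C z‖ : ℂ) / inner ℂ C z, ?_, by field_simp⟩
        rw [norm_div, norm_neg, Complex.norm_real, norm_norm, div_self (by simpa using h0)]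
    have := (h (θ • z) (by rwa [norm_smul, hθ, one_mul])).2
    rw [inner_smul_right, hθz, map_smul, norm_smul, hθ, one_mul, ← sub_eq_add_neg,
      ← Complex.ofReal_one, ← Complex.ofReal_sub, Complex.norm_real, Real.norm_eq_abs,
      abs_of_nonneg (by linarith)] at this
    linarith
  refine le_of_forall_gt_imp_ge_of_dense fun r hr => ?_
  have hr0 : 0 < r := (norm_nonneg w).trans_lt hr
  have := key ((r : ℂ)⁻¹ • w) (by
    rw [norm_smul, norm_inv, Complex.norm_real, Real.norm_of_nonneg hr0.le]
    rwa [inv_mul_lt_iff₀ hr0, mul_one])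
  rw [inner_smul_right, map_smul, norm_smul, norm_mul, norm_inv, Complex.norm_real,
    Real.norm_of_nonneg hr0.le, ← mul_add, inv_mul_le_iff₀ hr0, mul_one] at this
  exact this

variable [CompleteSpace E]

/-- A unimodular eigenvector of a contraction is an eigenvector of the adjoint. -/
theorem adjoint_apply_of_eigenvector {A : E →L[ℂ] E} (hA : ∀ x, ‖A x‖ ≤ ‖x‖) {lam : ℂ}
    (hlam : ‖lam‖ = 1) {x : E} (hx : A x = lam • x) :
    ContinuousLinearMap.adjoint A x = (starRingEnd ℂ lam) • x := by
  have hA' : ‖ContinuousLinearMap.adjoint A x‖ ≤ ‖x‖ := by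
    refine (ContinuousLinearMap.le_opNorm _ x).trans ?_
    rw [LinearIsometryEquiv.norm_map]
    have : ‖A‖ ≤ 1 := A.opNorm_le_bound zero_le_one (by simpa using hA)
    nlinarith [norm_nonneg x]
  have hin : inner ℂ (ContinuousLinearMap.adjoint A x) ((starRingEnd ℂ lam) • x)
      = ((‖x‖ ^ 2 : ℝ) : ℂ) := by
    rw [ContinuousLinearMap.adjoint_inner_left, map_smul, hx, smul_smul, inner_smul_right,
      ← Complex.normSq_eq_conj_mul_self, Complex.normSq_eq_norm_sq, hlam,
      inner_self_eq_norm_sq_to_K]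
    simp
  -- By `hin`, the squared distance equals `‖A* x‖² - ‖x‖²`, which is at most `0`.
  have h := norm_sub_sq (𝕜 := ℂ) (ContinuousLinearMap.adjoint A x) ((starRingEnd ℂ lam) • x)
  rw [hin, norm_smul, RCLike.norm_conj, hlam, one_mul] at h
  have h2 : RCLike.re ((‖x‖ ^ 2 : ℝ) : ℂ) = ‖x‖ ^ 2 := Complex.ofReal_re _
  rw [h2] at h
  have h3 : ‖ContinuousLinearMap.adjoint A x - (starRingEnd ℂ lam) • x‖ = 0 := by
    have h4 : ‖ContinuousLinearMap.adjoint A x‖ ^ 2 ≤ ‖x‖ ^ 2 := by gcongr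
    have := sq_nonneg ‖ContinuousLinearMap.adjoint A x - (starRingEnd ℂ lam) • x‖
    exact pow_eq_zero_iff two_ne_zero |>.1 (by linarith)
  exact sub_eq_zero.1 (norm_eq_zero.1 h3)

theorem inner_apply_of_eigenvector {A : E →L[ℂ] E} (hA : ∀ x, ‖A x‖ ≤ ‖x‖) {lam : ℂ}
    (hlam : ‖lam‖ = 1) {x : E} (hx : A x = lam • x) (y : E) :
    inner ℂ x (A y) = lam * inner ℂ x y := by
  rw [← ContinuousLinearMap.adjoint_inner_left, adjoint_apply_of_eigenvector hA hlam hx,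
    inner_smul_left, Complex.conj_conj]

/-- The denominator of a linear fractional self-map of the ball fixing `0` is constant if the
differential at `0` has a unimodular eigenvalue. -/
theorem eq_zero_of_norm_add_norm_inner_le {A : E →L[ℂ] E} {C : E}
    (h : ∀ w, ‖A w‖ + ‖inner ℂ C w‖ ≤ ‖w‖) {lam : ℂ} (hlam : ‖lam‖ = 1) {v : E} (hv : v ≠ 0)
    (hev : A v = lam • v) : C = 0 := by
  wlog hvn : ‖v‖ = 1 generalizing v
  · refine this (v := (‖v‖⁻¹ : ℂ) • v) (by simpa using hv) (by rw [map_smul, hev, smul_comm]) ?_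
    rw [norm_smul, norm_inv, Complex.norm_real, norm_norm, inv_mul_cancel₀ (by simpa using hv)]
  have hA : ∀ x, ‖A x‖ ≤ ‖x‖ := fun x => by linarith [h x, norm_nonneg (inner ℂ C x)]
  have hCv : inner ℂ C v = 0 := by
    have := h v
    rw [hev, norm_smul, hlam, one_mul] at this
    exact norm_eq_zero.1 (le_antisymm (by linarith) (norm_nonneg _))
  have hvC : inner ℂ v C = 0 := by rw [← inner_conj_symm, hCv, map_zero]
  -- The component of `A (v + C)` along `v` is `lam`. With `h` at `v + C` this gives `1 + ‖C‖² ≤ ‖v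
  -- + C‖ = √(1 + ‖C‖²)`.
  have h1 : 1 ≤ ‖A (v + C)‖ := by
    have h2 := norm_inner_le_norm (𝕜 := ℂ) v (A (v + C))
    rw [inner_apply_of_eigenvector hA hlam hev, inner_add_right, hvC, add_zero, norm_mul, hlam,
      one_mul, inner_self_eq_norm_sq_to_K] at h2
    simp only [norm_pow, RCLike.norm_ofReal, hvn, abs_one, one_pow, one_mul] at h2
    exact h2
  have h3 := h (v + C)
  rw [inner_add_right, hCv, zero_add, inner_self_eq_norm_sq_to_K] at h3
  simp only [norm_pow, RCLike.norm_ofReal, abs_norm] at h3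
  have h4 := norm_add_sq (𝕜 := ℂ) v C
  rw [hvC, map_zero, mul_zero, add_zero, hvn] at h4
  have h5 : ‖C‖ ^ 2 ≤ 0 := by nlinarith [sq_nonneg ‖C‖, norm_nonneg (v + C)]
  exact norm_eq_zero.1 (pow_eq_zero_iff two_ne_zero |>.1 (le_antisymm h5 (sq_nonneg _)))

end Hilbert
end LFT

namespace LFT

/-! ### Unimodular eigenspaces of a contraction. -/

section Contraction

theorem eigenspace_le_ker_pow {E : Type*} [AddCommGroup E] [Module ℂ E] (A : E →ₗ[ℂ] E) (lam : ℂ) {n : ℕ} (hn : n ≠ 0) :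
    Module.End.eigenspace A lam ≤ LinearMap.ker ((A - lam • LinearMap.id) ^ n) := by
  intro x hx
  obtain ⟨m, rfl⟩ := Nat.exists_eq_succ_of_ne_zero hn
  rw [Module.End.mem_eigenspace_iff] at hx
  rw [LinearMap.mem_ker, Nat.succ_eq_add_one, pow_succ, Module.End.mul_apply]
  simp [hx]

variable {E : Type*} [NormedAddCommGroup E] [InnerProductSpace ℂ E] [CompleteSpace E]

/-- There are no Jordan blocks: a vector `y = (A - lam) x` that is itself an eigenvector is
orthogonal to the range of `A - lam`, hence to itself. -/
theorem ker_pow_le_eigenspace {A : E →L[ℂ] E} (hA : ∀ x, ‖A x‖ ≤ ‖x‖) {lam : ℂ}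
    (hlam : ‖lam‖ = 1) (n : ℕ) :
    LinearMap.ker (((A : E →ₗ[ℂ] E) - lam • LinearMap.id) ^ n)
      ≤ Module.End.eigenspace (A : E →ₗ[ℂ] E) lam := by
  induction n with
  | zero =>
    intro x hx
    have : x = 0 := by simpa using hx
    simp [this]
  | succ n ih =>
    intro x hx
    rw [LinearMap.mem_ker, pow_succ, Module.End.mul_apply] at hx
    have hy := Module.End.mem_eigenspace_iff.1 (ih (LinearMap.mem_ker.2 hx))
    obtain ⟨y, hyx⟩ : ∃ y, y = A x - lam • x := ⟨_, rfl⟩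
    replace hy : A y = lam • y := hyx ▸ hy
    have h0 : inner ℂ y y = (0 : ℂ) := by
      nth_rw 2 [hyx]
      rw [inner_sub_right, inner_apply_of_eigenvector hA hlam hy, inner_smul_right, sub_self]
    rw [Module.End.mem_eigenspace_iff]
    exact sub_eq_zero.1 (hyx.symm.trans (inner_self_eq_zero.1 h0))

theorem orthogonalFamily_unimodular_eigenspaces {A : E →L[ℂ] E} (hA : ∀ x, ‖A x‖ ≤ ‖x‖)
    {ι : Type*} {lam : ι → ℂ} (hinj : Function.Injective lam) (hlam : ∀ i, ‖lam i‖ = 1) :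
    OrthogonalFamily ℂ (fun i => Module.End.eigenspace (A : E →ₗ[ℂ] E) (lam i))
      (fun i => (Module.End.eigenspace (A : E →ₗ[ℂ] E) (lam i)).subtypeₗᵢ) := by
  intro i j hij x y
  have hx := Module.End.mem_eigenspace_iff.1 x.2
  have hy := Module.End.mem_eigenspace_iff.1 y.2
  have h := inner_apply_of_eigenvector hA (hlam i) hx (y : E)
  rw [show A (y : E) = lam j • (y : E) from hy, inner_smul_right] at h
  have h1 : (lam j - lam i) * inner ℂ (x : E) (y : E) = 0 := by rw [sub_mul, h, sub_self]
  exact (mul_eq_zero.1 h1).resolve_left (sub_ne_zero.2 fun e => hij (hinj e.symm))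

/-- The span of the unimodular eigenspaces of a contraction has an orthonormal eigenbasis. -/
theorem exists_orthonormal_eigenvectors [FiniteDimensional ℂ E] {A : E →L[ℂ] E}
    (hA : ∀ x, ‖A x‖ ≤ ‖x‖) {V : Submodule ℂ E}
    (hV : V = ⨆ (lam : ℂ) (_ : ‖lam‖ = 1), Module.End.eigenspace (A : E →ₗ[ℂ] E) lam) {u : ℕ}
    (hu : Module.finrank ℂ V = u) :
    ∃ (e : Fin u → E) (lam : Fin u → ℂ), Orthonormal ℂ e ∧ (∀ i, ‖lam i‖ = 1) ∧
      (∀ i, A (e i) = lam i • e i) ∧ Submodule.span ℂ (Set.range e) = V := by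
  classical
  let ι := {μ : Module.End.Eigenvalues (A : E →ₗ[ℂ] E) // ‖(μ : ℂ)‖ = 1}
  let lam : ι → ℂ := fun i => (i.1 : ℂ)
  have hinj : Function.Injective lam := fun i j h => Subtype.ext (Subtype.ext h)
  have hfam := orthogonalFamily_unimodular_eigenspaces hA hinj fun i => i.2
  let b := fun i : ι => stdOrthonormalBasis ℂ (Module.End.eigenspace (A : E →ₗ[ℂ] E) (lam i))
  have hon := hfam.orthonormal_sigma_orthonormal (v_family := fun i => b i)
    fun i => (b i).orthonormal
  set f := fun a : (i : ι) × Fin (Module.finrank ℂ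
      (Module.End.eigenspace (A : E →ₗ[ℂ] E) (lam i))) => ((b a.1 a.2 : _) : E) with hf
  have hon' : Orthonormal ℂ f := hon
  have hspan : Submodule.span ℂ (Set.range f) = V := by
    apply le_antisymm
    · rw [Submodule.span_le, hV]
      rintro _ ⟨a, rfl⟩
      exact (le_iSup₂_of_le (f := fun (μ : ℂ) (_ : ‖μ‖ = 1) =>
        Module.End.eigenspace (A : E →ₗ[ℂ] E) μ) (lam a.1) a.1.2 le_rfl) (b a.1 a.2).2
    · rw [hV]
      refine iSup₂_le fun μ hμ => ?_
      by_cases hev : Module.End.HasEigenvalue (A : E →ₗ[ℂ] E) μ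
      · let i : ι := ⟨⟨μ, hev⟩, hμ⟩
        have h1 : Submodule.map (Module.End.eigenspace (A : E →ₗ[ℂ] E) (lam i)).subtype
            (Submodule.span ℂ (Set.range (b i))) = Module.End.eigenspace (A : E →ₗ[ℂ] E) μ := by
          rw [← (b i).coe_toBasis, (b i).toBasis.span_eq, Submodule.map_subtype_top]
          rfl
        rw [← h1, Submodule.map_span]
        refine Submodule.span_mono ?_
        rintro _ ⟨_, ⟨j, rfl⟩, rfl⟩
        exact ⟨⟨i, j⟩, rfl⟩
      · have h2 : Module.End.eigenspace (A : E →ₗ[ℂ] E) μ = ⊥ := by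
          by_contra h
          exact hev h
        rw [h2]
        exact bot_le
  have hcard := finrank_span_eq_card hon'.linearIndependent
  rw [hspan, hu] at hcard
  let g := (Fintype.equivFinOfCardEq hcard.symm).symm
  refine ⟨f ∘ g, fun i => lam (g i).1, hon'.comp _ g.injective, fun i => (g i).1.2, fun i => ?_, ?_⟩
  · exact Module.End.mem_eigenspace_iff.1 (b (g i).1 (g i).2).2
  · rw [g.surjective.range_comp, hspan]

end Contraction

/-! ### Splitting coordinates into the first `u` and the last `N - u`. -/

section Pair

variable {N u : ℕ} (h : u ≤ N)

theorem sum_fin_eq_add {M : Type*} [AddCommMonoid M] (f : Fin N → M) :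
    ∑ k, f k = ∑ i : Fin u, f (Fin.cast (Nat.add_sub_of_le h) (Fin.castAdd (N - u) i))
      + ∑ j : Fin (N - u), f (Fin.cast (Nat.add_sub_of_le h) (Fin.natAdd u j)) := by
  rw [← Fin.sum_univ_add (fun k => f (Fin.cast (Nat.add_sub_of_le h) k))]
  exact (Equiv.sum_comp (finCongr (Nat.add_sub_of_le h)) f).symm

@[simp]
theorem pair_left (z' : CSpace u) (z'' : CSpace (N - u)) (i : Fin u) :
    pair h z' z'' (Fin.cast (Nat.add_sub_of_le h) (Fin.castAdd (N - u) i)) = z' i := by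
  simp [pair]

@[simp]
theorem pair_right (z' : CSpace u) (z'' : CSpace (N - u)) (j : Fin (N - u)) :
    pair h z' z'' (Fin.cast (Nat.add_sub_of_le h) (Fin.natAdd u j)) = z'' j := by
  simp [pair]

theorem ext_of_split {x y : CSpace N}
    (h₁ : ∀ i : Fin u, x (Fin.cast (Nat.add_sub_of_le h) (Fin.castAdd (N - u) i))
      = y (Fin.cast (Nat.add_sub_of_le h) (Fin.castAdd (N - u) i)))
    (h₂ : ∀ j : Fin (N - u), x (Fin.cast (Nat.add_sub_of_le h) (Fin.natAdd u j))
      = y (Fin.cast (Nat.add_sub_of_le h) (Fin.natAdd u j))) : x = y := by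
  ext k
  obtain ⟨k, rfl⟩ := (finCongr (Nat.add_sub_of_le h)).surjective k
  refine Fin.addCases (fun i => ?_) (fun j => ?_) k
  · exact h₁ i
  · exact h₂ j

theorem norm_pair_zero (z'' : CSpace (N - u)) : ‖pair h 0 z''‖ = ‖z''‖ := by
  rw [← sq_eq_sq₀ (norm_nonneg _) (norm_nonneg _), EuclideanSpace.norm_sq_eq,
    EuclideanSpace.norm_sq_eq, sum_fin_eq_add h]
  simp

theorem pair_zero_smul (c : ℂ) (z'' : CSpace (N - u)) : pair h 0 (c • z'') = c • pair h 0 z'' :=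
  ext_of_split h (fun i => by simp) (fun j => by simp)

end Pair

/-- The spectrum is finite, so pointwise strict bounds survive the supremum; for `n = 0` the
supremum is empty, which covers `u = N`. -/
theorem spectralRadius_lt_one_of_forall_eigenvector {n : ℕ} (M : Matrix (Fin n) (Fin n) ℂ)
    (hM : ∀ (μ : ℂ) (x : CSpace n), x ≠ 0 → act M x = μ • x → ‖μ‖ < 1) :
    spectralRadius ℂ M < 1 := by
  have h1 : ∀ μ ∈ spectrum ℂ M, ‖μ‖₊ < 1 := by
    intro μ hμ
    rw [← Matrix.spectrum_toLpLin 2, ← Module.End.hasEigenvalue_iff_mem_spectrum] at hμ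
    obtain ⟨x, hx⟩ := hμ.exists_hasEigenvector
    exact hM μ x hx.2 hx.apply_eq_smul
  have hfin := Matrix.finite_spectrum M
  have h2 : spectralRadius ℂ M = hfin.toFinset.sup fun μ => (‖μ‖₊ : ENNReal) := by
    simp [spectralRadius, Finset.sup_eq_iSup]
  rw [h2, Finset.sup_lt_iff (by simp)]
  intro μ hμ
  exact_mod_cast h1 μ (by simpa using hμ)

/-- A contraction is unitarily equivalent to a block diagonal map, with a diagonal unitary block
acting on the unimodular eigenspaces and a block of spectral radius less than one. -/
theorem exists_unitary_block_form {N u : ℕ} (h : u ≤ N) {A : CSpace N →L[ℂ] CSpace N}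
    (hA : ∀ x, ‖A x‖ ≤ ‖x‖)
    (hu : Module.finrank ℂ (⨆ (lam : ℂ) (_ : ‖lam‖ = 1),
      Module.End.eigenspace (A : CSpace N →ₗ[ℂ] CSpace N) lam : Submodule ℂ (CSpace N)) = u) :
    ∃ (U : CSpace N ≃ₗᵢ[ℂ] CSpace N) (Λ : Matrix (Fin u) (Fin u) ℂ)
      (A₁ : Matrix (Fin (N - u)) (Fin (N - u)) ℂ),
      Λ.IsDiag ∧ Λ ∈ Matrix.unitaryGroup (Fin u) ℂ ∧ spectralRadius ℂ A₁ < 1 ∧ ‖act A₁‖ ≤ 1 ∧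
      ∀ z' z'', U (A (U.symm (pair h z' z''))) = pair h (act Λ z') (act A₁ z'') := by
  obtain ⟨e, lam, he, hlam, hAe, hspan⟩ := exists_orthonormal_eigenvectors hA rfl hu
  set l : Fin u → Fin N := fun i => Fin.cast (Nat.add_sub_of_le h) (Fin.castAdd (N - u) i) with hl
  set r : Fin (N - u) → Fin N := fun j => Fin.cast (Nat.add_sub_of_le h) (Fin.natAdd u j) with hr
  have hlinj : Function.Injective l := fun i j hij => by
    simpa [hl, Fin.ext_iff] using hij
  obtain ⟨b, hb⟩ : ∃ b : OrthonormalBasis (Fin N) ℂ (CSpace N), ∀ i, b (l i) = e i := by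
    let v : Fin N → CSpace N := Function.extend l e 0
    have hv : ∀ i, v (l i) = e i := fun i => hlinj.extend_apply e 0 i
    have hvo : Orthonormal ℂ ((Set.range l).domRestrict v) := by
      have h1 : e = (Set.range l).domRestrict v ∘ Equiv.ofInjective l hlinj := by
        ext1 i
        exact (hv i).symm
      have h2 : (Set.range l).domRestrict v = e ∘ (Equiv.ofInjective l hlinj).symm := by
        rw [h1, Function.comp_assoc, Equiv.self_comp_symm, Function.comp_id]
      rw [h2]
      exact he.comp _ (Equiv.injective _)
    obtain ⟨b, hb⟩ := hvo.exists_orthonormalBasis_extension_of_card_eq (by simp)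
    exact ⟨b, fun i => (hb _ ⟨i, rfl⟩).trans (hv i)⟩
  let Λ : Matrix (Fin u) (Fin u) ℂ := Matrix.diagonal lam
  -- The compression of `A` to the orthogonal complement of the unimodular eigenvectors.
  let A₁ : Matrix (Fin (N - u)) (Fin (N - u)) ℂ :=
    Matrix.of fun i j => inner ℂ (b (r i)) (A (b (r j)))
  have hblock : ∀ z' z'', b.repr (A (b.repr.symm (pair h z' z'')))
      = pair h (act Λ z') (act A₁ z'') := by
    intro z' z''
    have hsum : b.repr.symm (pair h z' z'')
        = ∑ i, z' i • e i + ∑ j, z'' j • b (r j) := by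
      rw [← b.sum_repr_symm, sum_fin_eq_add h]
      congr 1
      · exact Finset.sum_congr rfl fun i _ => by rw [pair_left]; congr 1; exact hb i
      · exact Finset.sum_congr rfl fun i _ => by rw [pair_right]
    have horth : ∀ i j, inner ℂ (b (r j)) (e i) = (0 : ℂ) := by
      intro i j
      rw [← hb i]
      refine b.orthonormal.2 fun hij => ?_
      have := congrArg Fin.val hij
      simp [hl, hr] at this
      omega
    have horth' : ∀ i j, inner ℂ (e i) (b (r j)) = (0 : ℂ) := fun i j => by
      rw [← inner_conj_symm, horth, map_zero]
    refine ext_of_split h (fun i => ?_) (fun j => ?_)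
    · rw [pair_left, b.repr_apply_apply, show b _ = e i from hb i,
        inner_apply_of_eigenvector hA (hlam i) (hAe i), hsum, inner_add_right,
        he.inner_right_fintype, inner_sum]
      simp [inner_smul_right, horth', Λ, Matrix.ofLp_toEuclideanCLM, Matrix.mulVec_diagonal]
    · rw [pair_right, b.repr_apply_apply, hsum]
      simp only [map_add, map_sum, map_smul, hAe, inner_add_right, inner_sum, inner_smul_right]
      have horth_cast : ∀ i, inner ℂ
          (b (Fin.cast (Nat.add_sub_of_le h) (Fin.natAdd u j))) (e i) = (0 : ℂ) :=
        fun i => horth i j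
      simp [horth_cast, A₁, Matrix.ofLp_toEuclideanCLM, Matrix.mulVec, dotProduct, mul_comm, hr]
  have hblock0 : ∀ z'', b.repr (A (b.repr.symm (pair h 0 z''))) = pair h 0 (act A₁ z'') := by
    intro z''
    rw [hblock, map_zero]
  have hcontr : ∀ z'', ‖act A₁ z''‖ ≤ ‖z''‖ := by
    intro z''
    rw [← norm_pair_zero h, ← hblock0, LinearIsometryEquiv.norm_map, ← norm_pair_zero h z'',
      ← b.repr.symm.norm_map (pair h 0 z'')]
    exact hA _
  refine ⟨b.repr, Λ, A₁, Matrix.isDiag_diagonal _, ?_, ?_, ?_, hblock⟩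
  · rw [Matrix.mem_unitaryGroup_iff, Matrix.star_eq_conjTranspose, Matrix.diagonal_conjTranspose,
      Matrix.diagonal_mul_diagonal, ← Matrix.diagonal_one]
    congr 1
    ext1 i
    rw [Pi.star_apply, Complex.star_def, Complex.mul_conj, Complex.normSq_eq_norm_sq, hlam]
    simp
  · refine spectralRadius_lt_one_of_forall_eigenvector A₁ fun μ x hx hμ => ?_
    have hxn : 0 < ‖x‖ := norm_pos_iff.2 hx
    have h1 : ‖μ‖ ≤ 1 := by
      have := hcontr x
      rw [hμ, norm_smul] at this
      nlinarith
    -- A unimodular eigenvector of `A₁` would lift to one of `A`, lying both in the span of `e` and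
    -- in its orthogonal complement.
    refine lt_of_le_of_ne h1 fun hμ1 => hx ?_
    set y := b.repr.symm (pair h 0 x) with hy
    have hAy : A y = μ • y := by
      apply b.repr.injective
      rw [hblock0, hμ, pair_zero_smul, map_smul, hy, LinearIsometryEquiv.apply_symm_apply]
    have hyV : y ∈ Submodule.span ℂ (Set.range e) := by
      rw [hspan]
      exact (le_iSup₂_of_le (f := fun (μ : ℂ) (_ : ‖μ‖ = 1) =>
        Module.End.eigenspace (A : CSpace N →ₗ[ℂ] CSpace N) μ) μ hμ1 le_rfl)
        (Module.End.mem_eigenspace_iff.2 hAy)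
    have hye : y ∈ (Submodule.span ℂ (Set.range e))ᗮ := by
      rw [Submodule.mem_orthogonal]
      intro w hw
      induction hw using Submodule.span_induction with
      | mem w hw =>
        obtain ⟨i, rfl⟩ := hw
        rw [← hb i, ← b.repr_apply_apply, hy, LinearIsometryEquiv.apply_symm_apply, pair_left]
        rfl
      | zero => exact inner_zero_left _
      | add w₁ w₂ _ _ h₁ h₂ => rw [inner_add_left, h₁, h₂, add_zero]
      | smul c w _ h₁ => rw [inner_smul_left, h₁, mul_zero]
    have hy0 : y = 0 := inner_self_eq_zero.1 ((Submodule.mem_orthogonal _ _).1 hye y hyV)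
    rw [← norm_eq_zero, ← norm_pair_zero h, ← b.repr.symm.norm_map, ← hy, hy0, norm_zero]
  · exact ContinuousLinearMap.opNorm_le_bound _ zero_le_one fun x => by
      rw [one_mul]; exact hcontr x

end LFT

namespace LFT

/-! ### The involutive automorphisms of the ball. -/

section Involution

variable {E : Type*} [NormedAddCommGroup E] [InnerProductSpace ℂ E]

/-- The involutive automorphism of the unit ball that exchanges `0` and `a`. -/
noncomputable def ballInvolution (a : E) (z : E) : E :=
  -- With `s = √(1 - ‖a‖²)`, the usual coefficient `(1 - s) / ‖a‖²` from the projection onto `a` is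
  -- written `1 / (1 + s)`, so `a = 0` needs no separate case.
  (1 - inner ℂ a z)⁻¹ • ((1 - inner ℂ a z / (1 + √(1 - ‖a‖ ^ 2) : ℝ)) • a
    - (√(1 - ‖a‖ ^ 2) : ℂ) • z)

theorem one_sub_inner_ne_zero {a z : E} (ha : ‖a‖ < 1) (hz : ‖z‖ < 1) :
    1 - inner ℂ a z ≠ 0 := by
  intro h
  have h1 := norm_inner_le_norm (𝕜 := ℂ) a z
  rw [← sub_eq_zero.1 h, norm_one] at h1
  nlinarith [norm_nonneg a, norm_nonneg z]

theorem ballInvolution_zero (a : E) : ballInvolution a 0 = a := by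
  simp [ballInvolution]

/-- This is the identity showing that the involution preserves the ball: the subtracted product is
positive there. -/
theorem norm_sq_numerator (a z : E) (ha : ‖a‖ < 1) :
    ‖(1 - inner ℂ a z / (1 + √(1 - ‖a‖ ^ 2) : ℝ)) • a - (√(1 - ‖a‖ ^ 2) : ℂ) • z‖ ^ 2
      = ‖1 - inner ℂ a z‖ ^ 2 - (1 - ‖a‖ ^ 2) * (1 - ‖z‖ ^ 2) := by
  have hs0 : 0 ≤ √(1 - ‖a‖ ^ 2) := Real.sqrt_nonneg _
  have hs2 : √(1 - ‖a‖ ^ 2) ^ 2 = 1 - ‖a‖ ^ 2 :=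
    Real.sq_sqrt (by nlinarith [norm_nonneg a])
  set s := √(1 - ‖a‖ ^ 2)
  set q : ℂ := inner ℂ a z
  have hs1 : 1 + s ≠ 0 := by positivity
  rw [norm_sub_sq (𝕜 := ℂ), inner_smul_left, inner_smul_right, norm_smul, norm_smul, mul_pow,
    mul_pow, Complex.norm_real, Real.norm_of_nonneg hs0, ← Complex.normSq_eq_norm_sq,
    ← Complex.normSq_eq_norm_sq]
  have ha2 : ‖a‖ ^ 2 = 1 - s ^ 2 := by linarith
  have hre : (1 - q / ((1 + s : ℝ) : ℂ)).re = 1 - q.re / (1 + s) := by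
    simp [-Complex.ofReal_add]
  have him : (1 - q / ((1 + s : ℝ) : ℂ)).im = -(q.im / (1 + s)) := by
    simp [-Complex.ofReal_add]
  have hcr : RCLike.re ((starRingEnd ℂ) (1 - q / ((1 + s : ℝ) : ℂ)) * ((s : ℂ) * q))
      = (1 - q.re / (1 + s)) * (s * q.re) - q.im / (1 + s) * (s * q.im) := by
    change Complex.re _ = _
    rw [Complex.mul_re, Complex.conj_re, Complex.conj_im, hre, him]
    simp
  change _ - 2 * RCLike.re ((starRingEnd ℂ) (1 - q / ((1 + s : ℝ) : ℂ)) * ((s : ℂ) * q)) + _ = _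
  rw [hcr, Complex.normSq_apply, Complex.normSq_apply, hre, him, ha2]
  simp only [Complex.sub_re, Complex.one_re, Complex.sub_im, Complex.one_im]
  field_simp
  ring

theorem norm_ballInvolution_lt_one {a z : E} (ha : ‖a‖ < 1) (hz : ‖z‖ < 1) :
    ‖ballInvolution a z‖ < 1 := by
  have hd : 0 < ‖1 - inner ℂ a z‖ := norm_pos_iff.2 (one_sub_inner_ne_zero ha hz)
  rw [ballInvolution, norm_smul, norm_inv, inv_mul_lt_iff₀ hd, mul_one]
  refine lt_of_pow_lt_pow_left₀ 2 hd.le ?_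
  rw [norm_sq_numerator a z ha]
  have h1 : 0 < 1 - ‖a‖ ^ 2 := by nlinarith [norm_nonneg a]
  have h2 : 0 < 1 - ‖z‖ ^ 2 := by nlinarith [norm_nonneg z]
  nlinarith [mul_pos h1 h2]

theorem ballInvolution_ballInvolution {a z : E} (ha : ‖a‖ < 1) (hz : ‖z‖ < 1) :
    ballInvolution a (ballInvolution a z) = z := by
  have hd := one_sub_inner_ne_zero ha hz
  have h1 : 0 < 1 - ‖a‖ ^ 2 := by nlinarith [norm_nonneg a]
  have hs0 : 0 < √(1 - ‖a‖ ^ 2) := Real.sqrt_pos.2 h1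
  have hs2 : √(1 - ‖a‖ ^ 2) ^ 2 = 1 - ‖a‖ ^ 2 := Real.sq_sqrt h1.le
  -- Eliminating `‖a‖²` in favour of the square root `s` leaves rational identities in `s` and `⟨a,
  -- z⟩`.
  have haa : inner ℂ a a = (1 : ℂ) - (√(1 - ‖a‖ ^ 2) : ℂ) ^ 2 := by
    rw [inner_self_eq_norm_sq_to_K, ← Complex.ofReal_pow √(1 - ‖a‖ ^ 2), hs2]
    simp
  have hw : inner ℂ a (ballInvolution a z)
      = (1 - (√(1 - ‖a‖ ^ 2) : ℂ) ^ 2 - inner ℂ a z) / (1 - inner ℂ a z) := by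
    have hs1 : (1 + (√(1 - ‖a‖ ^ 2) : ℂ)) ≠ 0 := by
      exact_mod_cast (by positivity : 1 + √(1 - ‖a‖ ^ 2) ≠ 0)
    rw [ballInvolution, inner_smul_right, inner_sub_right, inner_smul_right, inner_smul_right, haa]
    push_cast
    field_simp
    ring
  have hsC : (√(1 - ‖a‖ ^ 2) : ℂ) ≠ 0 := by exact_mod_cast hs0.ne'
  have hs1 : (1 + (√(1 - ‖a‖ ^ 2) : ℂ)) ≠ 0 := by
    exact_mod_cast (by positivity : 1 + √(1 - ‖a‖ ^ 2) ≠ 0)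
  rw [ballInvolution, hw]
  have hden : (1 : ℂ) - (1 - (√(1 - ‖a‖ ^ 2) : ℂ) ^ 2 - inner ℂ a z) / (1 - inner ℂ a z)
      = (√(1 - ‖a‖ ^ 2) : ℂ) ^ 2 / (1 - inner ℂ a z) := by
    field_simp
    ring
  rw [hden, ballInvolution]
  push_cast
  generalize (√(1 - ‖a‖ ^ 2) : ℂ) = s at *
  generalize inner ℂ a z = q at *
  match_scalars
  · field_simp
    ring
  · field_simp

theorem ballInvolution_self {a : E} (ha : ‖a‖ < 1) : ballInvolution a a = 0 := by
  have := ballInvolution_ballInvolution (a := a) (z := 0) ha (by simp)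
  rwa [ballInvolution_zero] at this

theorem differentiableOn_ballInvolution {a : E} (ha : ‖a‖ < 1) :
    DifferentiableOn ℂ (ballInvolution a) (ball 0 1) := by
  have hi : Differentiable ℂ fun z : E => (inner ℂ a z : ℂ) := (innerSL ℂ a).differentiable
  have h1 : DifferentiableOn ℂ (fun z : E => (1 - inner ℂ a z : ℂ)⁻¹) (ball 0 1) :=
    ((differentiable_const _).sub hi).differentiableOn.inv fun z hz =>
      one_sub_inner_ne_zero ha (by simpa using hz)
  have h2 : Differentiable ℂ fun z : E => (1 - inner ℂ a z / (1 + √(1 - ‖a‖ ^ 2) : ℝ)) • a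
      - (√(1 - ‖a‖ ^ 2) : ℂ) • z := by
    simp only [div_eq_mul_inv]
    exact (((differentiable_const _).sub (hi.mul_const _)).smul_const a).sub
      (differentiable_id.const_smul _)
  exact h1.smul h2.differentiableOn

end Involution

/-! ### Homogeneous coordinates. -/

section Projective

variable {E : Type*} [NormedAddCommGroup E] [InnerProductSpace ℂ E]

/-- `f` is induced on the unit ball by a linear map `L` of `E × ℂ` in homogeneous coordinates. -/
def IsProjectiveOnBall (f : E → E) : Prop :=
  ∃ L : E × ℂ →ₗ[ℂ] E × ℂ, ∀ z ∈ ball (0 : E) 1,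
    (L (z, 1)).2 ≠ 0 ∧ L (z, 1) = (L (z, 1)).2 • (f z, 1)

theorem IsProjectiveOnBall.comp {f g : E → E} (hg : IsProjectiveOnBall g)
    (hf : IsProjectiveOnBall f) (hm : MapsTo f (ball 0 1) (ball 0 1)) :
    IsProjectiveOnBall (g ∘ f) := by
  obtain ⟨L, hL⟩ := hf
  obtain ⟨M, hM⟩ := hg
  refine ⟨M ∘ₗ L, fun z hz => ?_⟩
  obtain ⟨h1, h2⟩ := hL z hz
  obtain ⟨h3, h4⟩ := hM (f z) (hm hz)
  have h5 : (M ∘ₗ L) (z, 1) = ((L (z, 1)).2 * (M (f z, 1)).2) • (g (f z), 1) := by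
    rw [LinearMap.comp_apply, h2, map_smul, h4]
    simp [smul_smul]
  rw [h5]
  simp [h1, h3]

theorem isProjectiveOnBall_of_eq {f : E → E} (A : E →ₗ[ℂ] E) (B : E) (c : E →ₗ[ℂ] ℂ) (D : ℂ)
    (h : ∀ z ∈ ball (0 : E) 1, c z + D ≠ 0 ∧ f z = (c z + D)⁻¹ • (A z + B)) :
    IsProjectiveOnBall f := by
  refine ⟨LinearMap.prod (A.coprod (LinearMap.toSpanSingleton ℂ E B))
    (c.coprod (LinearMap.toSpanSingleton ℂ ℂ D)), fun z hz => ?_⟩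
  obtain ⟨h1, h2⟩ := h z hz
  simp [h1, h2]

theorem isProjectiveOnBall_ballInvolution {a : E} (ha : ‖a‖ < 1) :
    IsProjectiveOnBall (ballInvolution a) := by
  refine isProjectiveOnBall_of_eq
    (-(((1 + √(1 - ‖a‖ ^ 2) : ℝ) : ℂ)⁻¹ • (innerₛₗ ℂ a).smulRight a)
      - (√(1 - ‖a‖ ^ 2) : ℂ) • LinearMap.id) a (-(innerₛₗ ℂ a)) 1 fun z hz => ?_
  have h1 := one_sub_inner_ne_zero ha (by simpa using hz : ‖z‖ < 1)
  have h2 : (-(innerₛₗ ℂ a)) z + 1 = 1 - inner ℂ a z := by simp [sub_eq_neg_add]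
  rw [h2]
  refine ⟨h1, ?_⟩
  rw [ballInvolution]
  congr 1
  simp only [LinearMap.sub_apply, LinearMap.neg_apply, LinearMap.smul_apply,
    LinearMap.smulRight_apply, innerₛₗ_apply_apply, LinearMap.id_apply]
  module

/-- Transfers closure under composition to linear fractional self-maps; conversely, the vector `C`
is recovered from `L` by Riesz duality. -/
theorem isLinearFractionalSelfMap_iff {N : ℕ} {f : CSpace N → CSpace N} :
    IsLinearFractionalSelfMap f ↔
      MapsTo f (unitBall N) (unitBall N) ∧ IsProjectiveOnBall f := by
  constructor
  · rintro ⟨hm, A, B, C, D, h⟩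
    exact ⟨hm, isProjectiveOnBall_of_eq (act A : CSpace N →ₗ[ℂ] CSpace N) B (innerₛₗ ℂ C) D h⟩
  · rintro ⟨hm, L, hL⟩
    let c : CSpace N →L[ℂ] ℂ :=
      LinearMap.toContinuousLinearMap (LinearMap.snd ℂ _ _ ∘ₗ L ∘ₗ LinearMap.inl ℂ _ _)
    let A : CSpace N →L[ℂ] CSpace N :=
      LinearMap.toContinuousLinearMap (LinearMap.fst ℂ _ _ ∘ₗ L ∘ₗ LinearMap.inl ℂ _ _)
    refine ⟨hm, (Matrix.toEuclideanCLM (n := Fin N) (𝕜 := ℂ)).symm A, (L (0, 1)).1,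
      (InnerProductSpace.toDual ℂ _).symm c, (L (0, 1)).2, fun z hz => ?_⟩
    obtain ⟨h1, h2⟩ := hL z hz
    have hsplit : L (z, 1) = L (z, 0) + L (0, 1) := by rw [← map_add]; simp
    have hc : inner ℂ ((InnerProductSpace.toDual ℂ _).symm c) z + (L (0, 1)).2
        = (L (z, 1)).2 := by
      rw [InnerProductSpace.toDual_symm_apply, hsplit]
      rfl
    have hA : act ((Matrix.toEuclideanCLM (n := Fin N) (𝕜 := ℂ)).symm A) z + (L (0, 1)).1
        = (L (z, 1)).1 := by
      rw [act, StarAlgEquiv.apply_symm_apply, hsplit]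
      rfl
    rw [hc, hA]
    refine ⟨h1, ?_⟩
    rw [congrArg Prod.fst h2, Prod.smul_fst, smul_smul, inv_mul_cancel₀ h1, one_smul]

end Projective

end LFT

/-! ### Reduction to a linear map and conclusion. -/

namespace LFT

/-- Since `e` intertwines `f` and `g`, it carries each kernel for `f` onto the one for `g` with the
same `lam`. -/
theorem finrank_iSup_ker_pow_conj {E : Type*} [AddCommGroup E] [Module ℂ E]
    (e : E ≃ₗ[ℂ] E) {f g : E →ₗ[ℂ] E} (hfg : g ∘ₗ e = (e : E →ₗ[ℂ] E) ∘ₗ f) (n : ℕ) :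
    Module.finrank ℂ (⨆ (lam : ℂ) (_ : ‖lam‖ = 1),
        LinearMap.ker ((g - lam • LinearMap.id) ^ n) : Submodule ℂ E)
      = Module.finrank ℂ (⨆ (lam : ℂ) (_ : ‖lam‖ = 1),
        LinearMap.ker ((f - lam • LinearMap.id) ^ n) : Submodule ℂ E) := by
  rw [← LinearEquiv.finrank_map_eq e
    (⨆ (lam : ℂ) (_ : ‖lam‖ = 1), LinearMap.ker ((f - lam • LinearMap.id) ^ n))]
  refine congrArg (fun W : Submodule ℂ E => Module.finrank ℂ W) ?_
  simp only [Submodule.map_iSup]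
  refine iSup_congr fun lam => iSup_congr fun _ => ?_
  have h1 : (g - lam • LinearMap.id) ∘ₗ e
      = (e : E →ₗ[ℂ] E) ∘ₗ (f - lam • LinearMap.id) := by
    rw [LinearMap.sub_comp, hfg, LinearMap.comp_sub]
    ext x
    simp
  have h2 := Module.End.commute_pow_left_of_commute h1 n
  ext x
  obtain ⟨y, rfl⟩ := e.surjective x
  have h3 := LinearMap.congr_fun h2 y
  rw [LinearMap.comp_apply, LinearMap.comp_apply, LinearEquiv.coe_coe] at h3
  rw [LinearMap.mem_ker, h3]
  simp

theorem IsLinearFractionalSelfMap.differentiableOn {N : ℕ} {φ : CSpace N → CSpace N}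
    (hφ : IsLinearFractionalSelfMap φ) : DifferentiableOn ℂ φ (unitBall N) := by
  obtain ⟨-, A, B, C, D, h⟩ := hφ
  have h1 : DifferentiableOn ℂ (fun z : CSpace N => (inner ℂ C z + D)⁻¹ • (act A z + B))
      (unitBall N) := by
    refine DifferentiableOn.smul (DifferentiableOn.inv ?_ fun z hz => (h z hz).1) ?_
    · exact ((innerSL ℂ C).differentiable.add_const D).differentiableOn
    · exact ((act A).differentiable.add_const B).differentiableOn
  exact h1.congr fun z hz => (h z hz).2

/-- The unitary index is invariant under conjugation by an involutive automorphism of the ball. -/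
theorem finrank_unitarySpace_involution_conj {N : ℕ} {φ σ : CSpace N → CSpace N}
    {z₀ : CSpace N} (hz₀ : z₀ ∈ unitBall N) (hfix : φ z₀ = z₀)
    (hφ : DifferentiableAt ℂ φ z₀) (hσ : DifferentiableOn ℂ σ (unitBall N))
    (hinv : ∀ z ∈ unitBall N, σ (σ z) = z) (h0 : σ 0 = z₀) :
    Module.finrank ℂ (unitarySpace (σ ∘ φ ∘ σ) 0) = unitaryIndex φ z₀ := by
  have hmem : (0 : CSpace N) ∈ unitBall N := mem_ball_self one_pos
  have hσz : σ z₀ = 0 := by rw [← h0, hinv 0 hmem]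
  have d0 : HasFDerivAt σ (fderiv ℂ σ 0) 0 :=
    (hσ.differentiableAt (isOpen_ball.mem_nhds hmem)).hasFDerivAt
  have dz : HasFDerivAt σ (fderiv ℂ σ z₀) z₀ :=
    (hσ.differentiableAt (isOpen_ball.mem_nhds hz₀)).hasFDerivAt
  have key : ∀ z ∈ unitBall N, HasFDerivAt (σ ∘ σ) (ContinuousLinearMap.id ℂ (CSpace N)) z :=
    fun z hz => (hasFDerivAt_id z).congr_of_eventuallyEq
      (Filter.eventually_of_mem (isOpen_ball.mem_nhds hz) hinv)
  have c0 : (fderiv ℂ σ z₀).comp (fderiv ℂ σ 0) = ContinuousLinearMap.id ℂ _ :=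
    (HasFDerivAt.comp 0 (h0.symm ▸ dz) d0).unique (key 0 hmem)
  have cz : (fderiv ℂ σ 0).comp (fderiv ℂ σ z₀) = ContinuousLinearMap.id ℂ _ :=
    (HasFDerivAt.comp z₀ (hσz.symm ▸ d0) dz).unique (key z₀ hz₀)
  -- Differentiating `σ ∘ σ = id` at `0` and at `z₀` shows that the two derivatives are mutually
  -- inverse.
  let e : CSpace N ≃ₗ[ℂ] CSpace N := LinearEquiv.ofLinearMap
    (fderiv ℂ σ z₀ : CSpace N →ₗ[ℂ] CSpace N) (fderiv ℂ σ 0 : CSpace N →ₗ[ℂ] CSpace N)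
    (by ext1 x; exact DFunLike.congr_fun c0 x) (by ext1 x; exact DFunLike.congr_fun cz x)
  have hd : fderiv ℂ (σ ∘ φ ∘ σ) 0 = (fderiv ℂ σ z₀).comp ((fderiv ℂ φ z₀).comp (fderiv ℂ σ 0)) := by
    refine HasFDerivAt.fderiv ?_
    refine HasFDerivAt.comp 0 ?_ (HasFDerivAt.comp 0 ?_ d0)
    · rw [Function.comp_apply, h0, hfix]
      exact dz
    · rw [h0]
      exact hφ.hasFDerivAt
  refine finrank_iSup_ker_pow_conj e ?_ N
  ext1 x
  rw [hd]
  have := DFunLike.congr_fun cz x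
  simp only [ContinuousLinearMap.comp_apply, ContinuousLinearMap.id_apply] at this
  simp [e, this]

theorem IsLinearFractionalSelfMap.exists_normal_form {N : ℕ} {φ : CSpace N → CSpace N}
    (hφ : IsLinearFractionalSelfMap φ) (h0 : φ 0 = 0) :
    ∃ (A : CSpace N →L[ℂ] CSpace N) (C : CSpace N), ∀ z ∈ unitBall N,
      1 + inner ℂ C z ≠ 0 ∧ φ z = (1 + inner ℂ C z)⁻¹ • A z := by
  obtain ⟨-, A, B, C, D, h⟩ := hφ
  obtain ⟨hD, hB⟩ := h 0 (mem_ball_self one_pos)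
  rw [inner_zero_right, zero_add] at hD hB
  have hB0 : B = 0 := by
    rw [h0, map_zero, zero_add] at hB
    exact (smul_eq_zero.1 hB.symm).resolve_left (inv_ne_zero hD)
  -- Numerator and denominator are divided by `D`; the conjugate appears because the inner product
  -- is conjugate-linear in `C`.
  refine ⟨D⁻¹ • act A, (starRingEnd ℂ D)⁻¹ • C, fun z hz => ?_⟩
  obtain ⟨h1, h2⟩ := h z hz
  have h3 : 1 + inner ℂ ((starRingEnd ℂ D)⁻¹ • C) z = D⁻¹ * (inner ℂ C z + D) := by
    rw [inner_smul_left, map_inv₀, Complex.conj_conj]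
    field_simp
    ring
  rw [h3]
  refine ⟨mul_ne_zero (inv_ne_zero hD) h1, ?_⟩
  rw [h2, hB0, add_zero, _root_.smul_apply, smul_smul]
  congr 1
  field_simp

/-- A linear fractional self-map of the ball that fixes `0` and whose differential at `0` has a
unimodular eigenvalue is linear. -/
theorem IsLinearFractionalSelfMap.exists_linear {N : ℕ} {φ : CSpace N → CSpace N}
    (hφ : IsLinearFractionalSelfMap φ) (h0 : φ 0 = 0)
    (hu : Module.finrank ℂ (unitarySpace φ 0) ≠ 0) :
    ∃ A : CSpace N →L[ℂ] CSpace N, (∀ x, ‖A x‖ ≤ ‖x‖) ∧ (∀ z ∈ unitBall N, φ z = A z) ∧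
      unitarySpace φ 0 = ⨆ (lam : ℂ) (_ : ‖lam‖ = 1),
        Module.End.eigenspace (A : CSpace N →ₗ[ℂ] CSpace N) lam := by
  obtain ⟨A, C, h⟩ := hφ.exists_normal_form h0
  have hmem : (0 : CSpace N) ∈ unitBall N := mem_ball_self one_pos
  have hbound := norm_add_norm_inner_le A C fun z hz => by
    have hz' : z ∈ unitBall N := by simpa using hz
    obtain ⟨h1, h2⟩ := h z hz'
    refine ⟨h1, ?_⟩
    have h3 : ‖φ z‖ < 1 := by simpa using hφ.1 hz'
    rw [h2, norm_smul, norm_inv, inv_mul_lt_iff₀ (norm_pos_iff.2 h1), mul_one] at h3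
    exact h3.le
  have hA : ∀ x, ‖A x‖ ≤ ‖x‖ := fun x => by
    linarith [hbound x, norm_nonneg (inner ℂ C x)]
  -- The derivative of the scalar factor drops out because it multiplies `A 0 = 0`.
  have hderiv : fderiv ℂ φ 0 = A := by
    have hi : DifferentiableAt ℂ (fun z : CSpace N => (1 + inner ℂ C z : ℂ)⁻¹) 0 :=
      DifferentiableAt.inv ((innerSL ℂ C).differentiableAt.const_add 1) (h 0 hmem).1
    have h1 := hi.hasFDerivAt.smul (A.hasFDerivAt (x := 0))
    have h2 := h1.congr_of_eventuallyEq (f₁ := φ)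
      (Filter.eventually_of_mem (isOpen_ball.mem_nhds hmem) fun z hz => (h z hz).2)
    rw [h2.fderiv]
    ext1 x
    simp
  -- Eigenvectors lie in the kernel of the `N`-th power only for a nonzero exponent.
  have hN : N ≠ 0 := by
    have := unitaryIndex_le φ 0
    unfold unitaryIndex at this
    omega
  have hspace : unitarySpace φ 0 = ⨆ (lam : ℂ) (_ : ‖lam‖ = 1),
      Module.End.eigenspace (A : CSpace N →ₗ[ℂ] CSpace N) lam := by
    unfold unitarySpace
    rw [hderiv]
    exact iSup_congr fun lam => iSup_congr fun hlam =>
      le_antisymm (ker_pow_le_eigenspace hA hlam N) (eigenspace_le_ker_pow _ lam hN)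
  obtain ⟨lam, hlam, v, hv, hev⟩ : ∃ lam : ℂ, ‖lam‖ = 1 ∧ ∃ v : CSpace N, v ≠ 0 ∧
      A v = lam • v := by
    by_contra! hcon
    refine hu ?_
    have hbot : unitarySpace φ 0 = ⊥ := by
      rw [hspace, eq_bot_iff]
      refine iSup₂_le fun lam hlam v hv => ?_
      by_contra hv0
      exact hcon lam hlam v hv0 (Module.End.mem_eigenspace_iff.1 hv)
    rw [hbot, finrank_bot]
  have hC := eq_zero_of_norm_add_norm_inner_le hbound hlam hv hev
  refine ⟨A, hA, fun z hz => ?_, hspace⟩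
  rw [(h z hz).2, hC]
  simp

end LFT

theorem mainTheorem11 {N : ℕ} (φ : LFT.CSpace N → LFT.CSpace N)
    (hφ : LFT.IsLinearFractionalSelfMap φ)
    (z₀ : LFT.CSpace N) (hz₀ : z₀ ∈ LFT.unitBall N) (hfix : φ z₀ = z₀)
    (hu : 1 ≤ LFT.unitaryIndex φ z₀) :
    ∃ (ψ : LFT.CSpace N → LFT.CSpace N)
      (Λ : Matrix (Fin (LFT.unitaryIndex φ z₀)) (Fin (LFT.unitaryIndex φ z₀)) ℂ)
      (A₁ : Matrix (Fin (N - LFT.unitaryIndex φ z₀)) (Fin (N - LFT.unitaryIndex φ z₀)) ℂ),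
      LFT.IsLinearFractionalSelfMap ψ ∧
      LFT.IsConjugate (LFT.unitBall N) (LFT.unitBall N) φ ψ ∧
      Λ.IsDiag ∧ Λ ∈ Matrix.unitaryGroup (Fin (LFT.unitaryIndex φ z₀)) ℂ ∧
      spectralRadius ℂ A₁ < 1 ∧ ‖LFT.act A₁‖ ≤ 1 ∧
      ∀ (z' : LFT.CSpace (LFT.unitaryIndex φ z₀))
        (z'' : LFT.CSpace (N - LFT.unitaryIndex φ z₀)),
        LFT.pair (LFT.unitaryIndex_le φ z₀) z' z'' ∈ LFT.unitBall N →
        ψ (LFT.pair (LFT.unitaryIndex_le φ z₀) z' z'') =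
          LFT.pair (LFT.unitaryIndex_le φ z₀) (LFT.act Λ z') (LFT.act A₁ z'') := by

  have hnorm : ∀ {z : LFT.CSpace N}, z ∈ LFT.unitBall N ↔ ‖z‖ < 1 := mem_ball_zero_iff
  have hz₀' : ‖z₀‖ < 1 := hnorm.1 hz₀
  set σ : LFT.CSpace N → LFT.CSpace N := LFT.ballInvolution z₀
  have hσ0 : σ 0 = z₀ := LFT.ballInvolution_zero z₀
  have hσm : MapsTo σ (LFT.unitBall N) (LFT.unitBall N) := fun z hz =>
    hnorm.2 (LFT.norm_ballInvolution_lt_one hz₀' (hnorm.1 hz))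
  have hσσ : ∀ z ∈ LFT.unitBall N, σ (σ z) = z := fun z hz =>
    LFT.ballInvolution_ballInvolution hz₀' (hnorm.1 hz)
  have hσd : DifferentiableOn ℂ σ (LFT.unitBall N) := LFT.differentiableOn_ballInvolution hz₀'
  have hσp : LFT.IsProjectiveOnBall σ := LFT.isProjectiveOnBall_ballInvolution hz₀'
  have hχ : LFT.IsLinearFractionalSelfMap (σ ∘ φ ∘ σ) :=
    LFT.isLinearFractionalSelfMap_iff.2 ⟨hσm.comp (hφ.1.comp hσm),
      hσp.comp ((LFT.isLinearFractionalSelfMap_iff.1 hφ).2.comp hσp hσm) (hφ.1.comp hσm)⟩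
  have hχ0 : (σ ∘ φ ∘ σ) 0 = 0 := by
    rw [Function.comp_apply, Function.comp_apply, hσ0, hfix]
    exact LFT.ballInvolution_self hz₀'
  have hindex := LFT.finrank_unitarySpace_involution_conj hz₀ hfix
    (hφ.differentiableOn.differentiableAt (isOpen_ball.mem_nhds hz₀)) hσd hσσ hσ0
  obtain ⟨A, hA, hχA, hspace⟩ := hχ.exists_linear hχ0 (by omega)
  rw [hspace] at hindex
  obtain ⟨U, Λ, A₁, hdiag, hunit, hrad, hle, hblock⟩ :=
    LFT.exists_unitary_block_form (LFT.unitaryIndex_le φ z₀) hA hindex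
  have hUm : MapsTo U (LFT.unitBall N) (LFT.unitBall N) := fun z hz =>
    hnorm.2 (by rw [U.norm_map]; exact hnorm.1 hz)
  have hUm' : MapsTo U.symm (LFT.unitBall N) (LFT.unitBall N) := fun z hz =>
    hnorm.2 (by rw [U.symm.norm_map]; exact hnorm.1 hz)
  have hψ : ∀ w ∈ LFT.unitBall N, U (A (U.symm w)) = U (σ (φ (σ (U.symm w)))) := fun w hw => by
    rw [← hχA _ (hUm' hw)]
    rfl
  -- The conjugating automorphism is `U ∘ σ`, with inverse `σ ∘ U.symm` because `σ` is an
  -- involution.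
  refine ⟨fun w => U (A (U.symm w)), Λ, A₁, LFT.isLinearFractionalSelfMap_iff.2 ⟨?_, ?_⟩,
    ⟨U ∘ σ, σ ∘ U.symm, ⟨hUm.comp hσm, hσm.comp hUm', ?_, ?_, ?_, ?_⟩, hψ⟩, hdiag, hunit, hrad,
    hle, fun z' z'' _ => hblock z' z''⟩
  · intro w hw
    show U (A (U.symm w)) ∈ _
    rw [hψ w hw]
    exact hUm (hσm (hφ.1 (hσm (hUm' hw))))
  · exact LFT.isProjectiveOnBall_of_eq
      ((U.toLinearEquiv : LFT.CSpace N →ₗ[ℂ] LFT.CSpace N) ∘ₗ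
        (A : LFT.CSpace N →ₗ[ℂ] LFT.CSpace N) ∘ₗ U.symm.toLinearEquiv) 0 0 1 (by simp)
  · intro z hz
    simp [hσσ z hz]
  · intro w hw
    simp [hσσ _ (hUm' hw)]
  · exact U.toContinuousLinearEquiv.differentiable.comp_differentiableOn hσd
  · exact hσd.comp U.symm.toContinuousLinearEquiv.differentiable.differentiableOn hUm'
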